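/- Let $(W,S)$ be a finite Coxeter system, given by its Coxeter matrix. The right weak order on $W$ is: $u\le w$ iff $w=us_1\cdots s_k$ with $s_i\in S$ and $\ell(us_1\cdots s_i)=\ell(u)+i$ for all $1\le i\le k$. The weak order graph $V(W)$ is the (undirected) Hasse graph of this order: its vertex set is $W$, and two elements are adjacent iff one covers the other. For $A\subseteq W$ let $\partial A$ be the set of edges of $V(W)$ connecting $A$ to $W\setminus A$. Then, according to the type of $(W,S)$, the following holds for every subset $A\subseteq W$. - $A_n$ ($n\ge 1$, $n\ne 2$): $$|\partial A|\ \ge\ \frac12\,\frac{(n+1)!}{n^{\binom{n+1}{2}}\binom{n+1}{2}\,2\sqrt{|\cos(\pi/n)|}}\,|A|\left(1-\frac{|A|}{(n+1)!}\right).$$ - $B_n$ ($n\ge 3$): $$|\partial A|\ \ge\ \frac12\,\frac{2^n n!}{n^{n^2}\,n^2\,2\sqrt{\cos(\pi/n)}}\,|A|\left(1-\frac{|A|}{2^n n!}\right).$$ - $D_n$ ($n\ge 3$): $$|\partial A|\ \ge\ \frac12\,\frac{2^{n-1}n!}{n^{n(n-1)}\,n(n-1)\,2\sqrt2}\,|A|\left(1-\frac{|A|}{2^{n-1}n!}\right).$$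 - $I_2(m)$ ($m\ge 2$; this includes $A_2=I_2(3)$ and $B_2=I_2(4)$): $$|\partial A|\ \ge\ \frac12\sqrt{\frac1{2^{m-1}}}\,|A|\left(1-\frac{|A|}{2m}\right).$$ - For the exceptional types, $|\partial A|\ge c\,|A|\left(1-\frac{|A|}{N}\right)$ holds for both of the following constants $c=c_1$ and $c=c_2$: - $E_6$: $N=51840$, $\;c_1=\frac12\,\frac{51840}{12^{36}\cdot 36\sqrt{4.8}}$, $\;c_2=\frac12\,\frac{51840}{6^{36}\cdot 36\sqrt{4.8}}$; - $E_7$: $N=2903040$, $\;c_1=\frac12\,\frac{2903040}{12^{36}\cdot 36\sqrt{4.8}}$, $\;c_2=\frac12\,\frac{2903040}{7^{63}\cdot 63\sqrt{4.8}}$; - $E_8$: $N=696729600$, $\;c_1=\frac12\,\frac{696729600}{30^{120}\cdot 20\sqrt{4.8}}$, $\;c_2=\frac12\,\frac{696729600}{8^{120}\cdot 120\sqrt{4.8}}$; - $F_4$: $N=1152$, $\;c_1=\frac12\,\frac{1152}{12^{24}\cdot 24\sqrt{2\sqrt2}}$, $\;c_2=\frac12\,\frac{1152}{4^{24}\cdot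 24\sqrt{2\sqrt2}}$; - $H_3$: $N=120$, $\;c_1=\frac{4}{10^{15}\sqrt{2\sqrt3}}$, $\;c_2=\frac12\,\frac{120}{3^{15}\cdot 15\sqrt2}$; - $H_4$: $N=14400$, $\;c_1=\frac12\,\frac{14400}{30^{60}\cdot 60\sqrt{2\sqrt2}}$, $\;c_2=\frac12\,\frac{14400}{4^{60}\cdot 60\sqrt{2\sqrt2}}$. -/

import Mathlib

namespace WeakOrder

/-- The Coxeter matrix of type `D n` (for `3 ≤ n`): the nodes `0, …, n - 2` form a path and the
last node `n - 1` is joined to the node `n - 3` only. All edges have label `3`.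
(`CoxeterMatrix.D` of the library keeps the additional edge between `n - 2` and `n - 1`, so that
its diagram contains a triangle; it is therefore not used here.) -/
def typeD (n : ℕ) : CoxeterMatrix (Fin n) where
  M := Matrix.of fun i j : Fin n ↦
    if i = j then 1
    else if ((i : ℕ) + 1 = j ∧ (j : ℕ) + 1 < n) ∨ ((j : ℕ) + 1 = i ∧ (i : ℕ) + 1 < n) ∨
        ((i : ℕ) + 1 = n ∧ (j : ℕ) + 3 = n) ∨ ((j : ℕ) + 1 = n ∧ (i : ℕ) + 3 = n) then 3
    else 2
  isSymm := by
    ext i j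
    simp only [Matrix.transpose_apply, Matrix.of_apply]
    grind
  diagonal := by simp
  off_diagonal := by
    intro i j h
    simp only [Matrix.of_apply]
    grind

section

variable {B W : Type*} [Group W] {M : CoxeterMatrix B} (cs : CoxeterSystem M W)

/-- The right weak order: `u ≤ w` iff `w = u s₁ ⋯ sₖ` for simple reflections `s₁, …, sₖ` such that
`ℓ (u s₁ ⋯ sᵢ) = ℓ u + i` for all `i ≤ k`. -/
def RightLE (u w : W) : Prop :=
  ∃ ω : List B, w = u * cs.wordProd ω ∧
    ∀ i ≤ ω.length, cs.length (u * cs.wordProd (ω.take i)) = cs.length u + i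

/-- The right weak order, as a partial order on `W`. -/
@[reducible] def rightWeakOrder : PartialOrder W where
  le := RightLE cs
  le_refl u := ⟨[], by simp, by simp⟩
  le_trans := by
    rintro u v w ⟨ω, rfl, h⟩ ⟨ω', rfl, h'⟩
    refine ⟨ω ++ ω', by rw [cs.wordProd_append, mul_assoc], fun i hi ↦ ?_⟩
    rcases le_total i ω.length with hle | hle
    · rw [List.take_append_of_le_length hle]
      exact h i hle
    · obtain ⟨j, rfl⟩ := Nat.exists_eq_add_of_le hle
      have hl := h ω.length le_rfl
      rw [List.take_length] at hl
      have hj := h' j (by rw [List.length_append] at hi; omega)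
      rw [List.take_length_add_append, cs.wordProd_append, ← mul_assoc, hj, hl, add_assoc]
  le_antisymm := by
    rintro u v ⟨ω, rfl, h⟩ ⟨ω', h1, h'⟩
    have hl := h ω.length le_rfl
    have hl' := h' ω'.length le_rfl
    rw [List.take_length] at hl hl'
    rw [← h1] at hl'
    have h0 : ω = [] := List.length_eq_zero_iff.mp (by omega)
    simp [h0]

/-- The weak order graph `V(W)`: the Hasse graph of the right weak order, in which `u` and `w` are
adjacent iff one of them covers the other. -/
def weakOrderGraph : SimpleGraph W :=
  letI := rightWeakOrder cs
  SimpleGraph.hasse W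

end

/-- The edge boundary `∂A`: the set of all edges connecting `A` to its complement. -/
def edgeBoundary {V : Type*} (G : SimpleGraph V) (A : Set V) : Set (Sym2 V) :=
  {e | e ∈ G.edgeSet ∧ ∃ a ∈ A, ∃ b ∉ A, e = s(a, b)}

/-- `Isoperimetric G c N` says that `|∂A| ≥ c |A| (1 - |A| / N)` for all sets `A` of vertices. -/
def Isoperimetric {V : Type*} (G : SimpleGraph V) (c : ℝ) (N : ℕ) : Prop :=
  ∀ A : Set V,
    ((edgeBoundary G A).ncard : ℝ) ≥ c * (A.ncard : ℝ) * (1 - (A.ncard : ℝ) / (N : ℝ))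

end WeakOrder

/-! The constants are so small that connectedness of the graph is enough. A nonempty proper subset
`A` has at least one boundary edge, while x(1 - x/N) ≤ N/4 for every real x. Hence `c * N ≤ 4`
settles every finite `A` except the whole group (`isoperimetric_of_le`). For `A = W` the boundary is
empty and the right-hand side must be nonpositive, which says N ≤ |W|. So only lower bounds on the
group orders are needed.

These come from orbit–stabilizer along a chain of standard parabolic subgroups
(`card_mul_card_parabolic_le`): if W_J fixes a point x, then |W_K| is at least |W_J| times the
number of points known to lie in the W_K-orbit of x. The actions are reflection representations
obtained from the Coxeter relations (`exists_reflection_action`). Types A, B and D act on integer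
sequences and the points are (signed) basis vectors. The exceptional types act on weights modulo 29,
where the kernel enumerates orbits of fundamental weights (`prod_le_card`); modulo 29 the residue 6
satisfies 6² = 6 + 1, so the H types need no extension ring. For I₂(m) there is a surjection onto
the dihedral group. -/

namespace WeakOrder

/-! ### Edges and connectedness of the weak order graph -/

section Graph

variable {B W : Type*} [Group W] {M : CoxeterMatrix B} (cs : CoxeterSystem M W)

theorem RightLE.length_add {u w : W} (h : RightLE cs u w) :
    cs.length u ≤ cs.length w ∧ (cs.length u = cs.length w → u = w) := by
  obtain ⟨ω, rfl, h⟩ := h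
  have hl := h ω.length le_rfl
  rw [List.take_length] at hl
  refine ⟨by omega, fun he ↦ ?_⟩
  have h0 : ω = [] := List.length_eq_zero_iff.mp (by omega)
  simp [h0]

theorem rightLE_mul_simple {u : W} {i : B} (h : cs.length (u * cs.simple i) = cs.length u + 1) :
    RightLE cs u (u * cs.simple i) := by
  refine ⟨[i], by simp, fun k hk ↦ ?_⟩
  obtain rfl | rfl : k = 0 ∨ k = 1 := by simp at hk; omega
  · simp
  · simpa using h

/-- Length increases strictly along the order, so nothing fits between elements whose lengths differ
by one. -/
theorem covBy_mul_simple {u : W} {i : B} (h : cs.length (u * cs.simple i) = cs.length u + 1) :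
    letI := rightWeakOrder cs
    u ⋖ u * cs.simple i := by
  let := rightWeakOrder cs
  have hne : u ≠ u * cs.simple i := fun he ↦ by rw [← he] at h; omega
  refine ⟨lt_of_le_of_ne (rightLE_mul_simple cs h) hne, fun v huv hvw ↦ ?_⟩
  have h1 := RightLE.length_add cs huv.le
  have h2 := RightLE.length_add cs hvw.le
  rcases Nat.lt_or_ge (cs.length u) (cs.length v) with h3 | h3
  · exact hvw.ne (h2.2 (by omega))
  · exact huv.ne (h1.2 (by omega))

theorem weakOrderGraph_adj_mul_simple (u : W) (i : B) :
    (weakOrderGraph cs).Adj u (u * cs.simple i) := by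
  rcases cs.length_mul_simple u i with h | h
  · exact Or.inl (covBy_mul_simple cs h)
  · refine Or.inr ?_
    have := covBy_mul_simple cs (u := u * cs.simple i) (i := i) (by simp [h])
    simpa using this

/-- The first step of a chain from `u` to `w` already lies strictly above `u` and weakly below `w`,
so it must be `w`. -/
theorem exists_eq_mul_simple_of_covBy {u w : W}
    (h : letI := rightWeakOrder cs
      u ⋖ w) : ∃ i, w = u * cs.simple i := by
  let := rightWeakOrder cs
  obtain ⟨ω, hw, hω⟩ := h.le
  cases ω with
  | nil => exact absurd (by simpa using hw.symm) h.ne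
  | cons i ω =>
    refine ⟨i, ?_⟩
    have h1 := hω 1 (by simp)
    simp only [List.take_succ_cons, List.take_zero, cs.wordProd_singleton] at h1
    have hlt : u < u * cs.simple i := (covBy_mul_simple cs h1).lt
    have hle : RightLE cs (u * cs.simple i) w := by
      refine ⟨ω, by rw [hw, cs.wordProd_cons, mul_assoc], fun k hk ↦ ?_⟩
      have h2 := hω (k + 1) (by simpa using hk)
      rw [List.take_succ_cons, cs.wordProd_cons, ← mul_assoc] at h2
      omega
    by_contra hne
    exact h.2 hlt (lt_of_le_of_ne hle (Ne.symm hne))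

theorem exists_eq_mul_simple_of_adj {u w : W} (h : (weakOrderGraph cs).Adj u w) :
    ∃ i, w = u * cs.simple i := by
  rcases h with h | h
  · exact exists_eq_mul_simple_of_covBy cs h
  · obtain ⟨i, rfl⟩ := exists_eq_mul_simple_of_covBy cs h
    exact ⟨i, by simp⟩

/-- Each vertex has at most |B| neighbours. Finiteness matters because `ncard` of an infinite set is
0. -/
theorem edgeBoundary_finite [Finite B] {A : Set W} (hA : A.Finite) :
    (edgeBoundary (weakOrderGraph cs) A).Finite := by
  refine (Set.Finite.image (fun p : W × B ↦ s(p.1, p.1 * cs.simple p.2))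
    (hA.prod Set.finite_univ)).subset ?_
  rintro _ ⟨he, a, ha, b, -, rfl⟩
  obtain ⟨i, hi⟩ := exists_eq_mul_simple_of_adj cs he
  exact ⟨(a, i), ⟨ha, trivial⟩, by simp [← show b = a * cs.simple i from hi]⟩

/-- With no boundary edge, `A` would be stable under right multiplication by simple reflections,
which generate `W`. -/
theorem edgeBoundary_nonempty {A : Set W} (hA : A.Nonempty) (hA' : A ≠ Set.univ) :
    (edgeBoundary (weakOrderGraph cs) A).Nonempty := by
  by_contra hemp
  obtain ⟨a, ha⟩ := hA
  have hstep : ∀ u ∈ A, ∀ i, u * cs.simple i ∈ A := fun u hu i ↦ by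
    by_contra hn
    exact hemp ⟨_, weakOrderGraph_adj_mul_simple cs u i, u, hu, _, hn, rfl⟩
  refine hA' (Set.eq_univ_of_forall fun w ↦ ?_)
  have : ∀ v, a * v ∈ A := fun v ↦
    cs.simple_induction_right (p := fun v ↦ a * v ∈ A) v (by simpa using ha)
      (fun v i hv ↦ by rw [← mul_assoc]; exact hstep _ hv i)
  simpa using this (a⁻¹ * w)

/-- The weak order graph is connected. Hence a constant `c ≤ 4 / N` is isoperimetric
as soon as the group has at least `N` elements. -/
theorem isoperimetric_of_le [Finite B] {c : ℝ} {N : ℕ} (hc : 0 ≤ c) (hN : 0 < N)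
    (hcN : c * N ≤ 4) (hcard : Finite W → N ≤ Nat.card W) :
    Isoperimetric (weakOrderGraph cs) c N := by
  intro A
  have hN' : (0 : ℝ) < N := by exact_mod_cast hN
  rcases A.finite_or_infinite with hA | hA
  swap
  -- An infinite `A` has `ncard` 0, so the bound reads 0 ≤ |∂A|.
  · simp [hA.ncard]
  rcases A.eq_empty_or_nonempty with rfl | hne
  · simp
  -- The only case that uses the group order: the factor 1 - |W|/N must be nonpositive.
  by_cases hu : A = Set.univ
  · subst hu
    have hfin : Finite W := Set.finite_univ_iff.mp hA
    have hle : (N : ℝ) ≤ (Set.univ : Set W).ncard := by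
      rw [Set.ncard_univ]; exact_mod_cast hcard hfin
    have h1 : 1 - ((Set.univ : Set W).ncard : ℝ) / N ≤ 0 := by
      rw [sub_nonpos, one_le_div hN']; exact hle
    exact (mul_nonpos_of_nonneg_of_nonpos (by positivity) h1).trans (by positivity)
  have h1 : (1 : ℝ) ≤ (edgeBoundary (weakOrderGraph cs) A).ncard := by
    have := (Set.ncard_pos (edgeBoundary_finite cs hA)).mpr (edgeBoundary_nonempty cs hne hu)
    exact_mod_cast this
  refine le_trans ?_ h1
  generalize (A.ncard : ℝ) = x
  have h2 : x * (1 - x / N) ≤ N / 4 := by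
    have : (N : ℝ) / 4 - x * (1 - x / N) = (x - N / 2) ^ 2 / N := by field_simp; ring
    have h3 : 0 ≤ (x - N / 2) ^ 2 / (N : ℝ) := by positivity
    linarith
  calc c * x * (1 - x / N) = c * (x * (1 - x / N)) := by ring
    _ ≤ c * (N / 4) := by gcongr
    _ ≤ 1 := by linarith

end Graph

/-! ### Orbit–stabilizer for parabolic subgroups -/

section Parabolic

variable {B W : Type*} [Group W] {M : CoxeterMatrix B} (cs : CoxeterSystem M W)

/-- The standard parabolic subgroup generated by the simple reflections in `J`. -/
def parabolic (J : Set B) : Subgroup W := Subgroup.closure (cs.simple '' J)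

/-- The points that can be reached from `x` by applying maps `σ j` with `j ∈ K`. -/
inductive Reach {X : Type*} (σ : B → X → X) (K : Set B) (x : X) : X → Prop
  | refl : Reach σ K x x
  | step {y : X} {j : B} : Reach σ K x y → j ∈ K → Reach σ K x (σ j y)

/-- Orbit–stabilizer for W_K acting at `x`: the orbit contains `O` and the stabilizer contains W_J.
Neither has to be determined exactly. -/
theorem card_mul_card_parabolic_le [Finite W] {X : Type*} (ρ : W →* Function.End X) {J K : Set B}
    (hJK : J ⊆ K) {x : X} (hfix : ∀ j ∈ J, ρ (cs.simple j) x = x) (O : Finset X)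
    (hO : ∀ y ∈ O, Reach (fun j ↦ (ρ (cs.simple j) : X → X)) K x y) :
    O.card * Nat.card (parabolic cs J) ≤ Nat.card (parabolic cs K) := by
  let act : MulAction W X := MulAction.compHom X ρ
  let H := parabolic cs K
  have hfin : (MulAction.orbit H x).Finite := Set.finite_range _
  have h1 : (MulAction.orbit H x).ncard * Nat.card (MulAction.stabilizer H x) = Nat.card H := by
    rw [← Nat.card_coe_set_eq, ← Nat.card_prod]
    exact Nat.card_congr (MulAction.orbitProdStabilizerEquivGroup H x)
  rw [← h1]
  refine Nat.mul_le_mul ?_ ?_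
  · rw [← Set.ncard_coe_finset]
    refine Set.ncard_le_ncard (fun y hy ↦ ?_) hfin
    have hy' := hO y hy
    clear hy
    induction hy' with
    | refl => exact MulAction.mem_orbit_self x
    | @step z j _ hj ih =>
      obtain ⟨g, rfl⟩ := ih
      exact ⟨⟨cs.simple j, Subgroup.subset_closure ⟨j, hj, rfl⟩⟩ * g, mul_smul _ _ _⟩
  · have hle : parabolic cs J ≤ H := Subgroup.closure_mono (Set.image_mono hJK)
    have hst : parabolic cs J ≤ MulAction.stabilizer W x := by
      refine (Subgroup.closure_le _).mpr ?_
      rintro _ ⟨j, hj, rfl⟩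
      exact hfix j hj
    refine Nat.card_le_card_of_injective
      (fun w : parabolic cs J ↦ (⟨⟨w, hle w.2⟩, hst w.2⟩ : MulAction.stabilizer H x)) ?_
    intro a b hab
    exact Subtype.ext (congrArg (fun u : MulAction.stabilizer H x ↦ ((u : H) : W)) hab)

theorem one_le_card_parabolic [Finite W] (J : Set B) : 1 ≤ Nat.card (parabolic cs J) :=
  Nat.card_pos

theorem card_parabolic_le [Finite W] (J : Set B) : Nat.card (parabolic cs J) ≤ Nat.card W :=
  Subgroup.card_le_card_group _

end Parabolic

/-! ### Reflection representations -/

section Reflection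

variable {R V : Type*} [CommRing R] [AddCommGroup V] [Module R V]

/-- The map `v ↦ v - f v • a`. -/
def refl (a : V) (f : V →ₗ[R] R) : Module.End R V := LinearMap.id - f.smulRight a

theorem refl_apply (a : V) (f : V →ₗ[R] R) (v : V) : refl a f v = v - f v • a := rfl

/-- The condition on the product `f a' * f' a` which makes `refl a f * refl a' f'`
have order dividing `m`, for the values `m` occurring in the finite types of rank at least `3`. -/
def Compatible (m : ℕ) (p q : R) : Prop :=
  (m = 2 ∧ p = 0 ∧ q = 0) ∨ (m = 3 ∧ p * q = 1) ∨ (m = 4 ∧ p * q = 2) ∨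
    (m = 5 ∧ (p * q) ^ 2 = 3 * (p * q) - 1)

/-- The product changes `v` only by multiples of `a` and `b`, governed by the pair (f v, g v), on
which it acts linearly. After `m` steps both coefficients are multiples of the polynomial relation
on p q = 4 cos²(kπ/m) stated in `Compatible`. For m = 2 both p and q must vanish. -/
theorem refl_mul_refl_pow {a b : V} {f g : V →ₗ[R] R} {m : ℕ} (ha : f a = 2) (hb : g b = 2)
    (h : Compatible m (f b) (g a)) : (refl a f * refl b g) ^ m = 1 := by
  generalize hp : f b = p at h
  generalize hq : g a = q at h
  have hab : ∀ x y : R, ∀ v, f v = x → g v = y → refl a f (refl b g v) =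
      v + (-x + p * y) • a + (-y) • b ∧ f (refl a f (refl b g v)) = -x + p * y ∧
        g (refl a f (refl b g v)) = -y - q * x + p * q * y := by
    rintro _ _ v rfl rfl
    simp only [refl_apply, map_sub, map_smul, smul_eq_mul, ha, hb, hp, hq]
    refine ⟨by module, by ring, by ring⟩
  ext v
  obtain ⟨e1, f1, g1⟩ := hab _ _ v rfl rfl
  obtain ⟨e2, f2, g2⟩ := hab _ _ _ f1 g1
  obtain ⟨e3, f3, g3⟩ := hab _ _ _ f2 g2
  obtain ⟨e4, f4, g4⟩ := hab _ _ _ f3 g3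
  obtain ⟨e5, f5, g5⟩ := hab _ _ _ f4 g4
  -- `z` is the relation satisfied by p q; the cofactors `c` and `d` below come from expanding the
  -- m-th power.
  have key : ∀ z c d : R, z = 0 → v + (c * z) • a + (d * z) • b = v := by
    rintro _ c d rfl; simp
  rcases h with ⟨rfl, h, h'⟩ | ⟨rfl, h⟩ | ⟨rfl, h⟩ | ⟨rfl, h⟩ <;>
    simp only [pow_succ, pow_zero, one_mul, Module.End.mul_apply, Module.End.one_apply]
  · subst h h'
    rw [e2, e1]
    module
  · rw [e3, e2, e1]
    refine Eq.trans ?_ (key (p * q - 1) ((1 - p * q) * f v + (p * q - 2) * p * g v)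
      (q * f v + (1 - p * q) * g v) (by rw [h, sub_self]))
    module
  · rw [e4, e3, e2, e1]
    refine Eq.trans ?_ (key (p * q - 2)
      ((2 * (p * q) - (p * q) ^ 2) * f v + (1 - 3 * (p * q) + (p * q) ^ 2) * p * g v)
      ((p * q - 1) * q * f v + (2 * (p * q) - (p * q) ^ 2) * g v) (by rw [h, sub_self]))
    module
  · rw [e5, e4, e3, e2, e1]
    refine Eq.trans ?_ (key ((p * q) ^ 2 - (3 * (p * q) - 1))
      ((-1 + 3 * (p * q) - (p * q) ^ 2) * f v + (3 - 4 * (p * q) + (p * q) ^ 2) * p * g v)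
      ((p * q - 2) * q * f v + (-1 + 3 * (p * q) - (p * q) ^ 2) * g v) (by rw [h, sub_self]))
    module

variable {B W : Type*} [Group W] {M : CoxeterMatrix B} (cs : CoxeterSystem M W)

theorem exists_reflection_action (a : B → V) (f : B → V →ₗ[R] R) (h2 : ∀ i, f i (a i) = 2)
    (h : ∀ i j, i ≠ j → Compatible (M i j) (f i (a j)) (f j (a i))) :
    ∃ ρ : W →* Function.End V, ∀ i v, ρ (cs.simple i) v = v - f i v • a i := by
  have hl : M.IsLiftable fun i ↦ refl (a i) (f i) := by
    intro i j
    rcases eq_or_ne i j with rfl | hij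
    · rw [M.diagonal, pow_one]
      ext v
      simp only [Module.End.mul_apply, refl_apply, map_sub, map_smul, h2,
        Module.End.one_apply]
      module
    · exact refl_mul_refl_pow (h2 i) (h2 j) (h i j hij)
  let φ : Module.End R V →* Function.End V :=
    { toFun := fun u ↦ (u : V → V), map_one' := rfl, map_mul' := fun _ _ ↦ rfl }
  refine ⟨φ.comp (cs.lift ⟨_, hl⟩), fun i v ↦ ?_⟩
  rw [MonoidHom.comp_apply, cs.lift_apply_simple]
  rfl

end Reflection

/-! ### Kernel enumeration of weight orbits modulo 29 -/

section Computation

/-- Apply `f` to a natural number which the kernel evaluates first. -/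
def force {α : Type*} (n : ℕ) (f : ℕ → α) : α := Nat.casesOn n (f 0) fun k ↦ f (k + 1)

theorem force_eq {α : Type*} (n : ℕ) (f : ℕ → α) : force n f = f n := by
  cases n <;> rfl

/-- The sum `v + c • d` of vectors whose coordinates represent residue classes modulo `29`. -/
def addMul (c : ℕ) (v d : List ℕ) : List ℕ := List.zipWith (fun x y ↦ (x + c * y) % 29) v d

/-- Apply `f` to `addMul c v d`, evaluated coordinate by coordinate. -/
def withAddMul {α : Type*} (c : ℕ) : List ℕ → List ℕ → (List ℕ → α) → α
  | x :: v, y :: d, f => force ((x + c * y) % 29) fun z ↦ withAddMul c v d fun u ↦ f (z :: u)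
  | _, _, f => f []

theorem withAddMul_eq {α : Type*} (c : ℕ) (v d : List ℕ) (f : List ℕ → α) :
    withAddMul c v d f = f (addMul c v d) := by
  induction v generalizing d f with
  | nil => cases d <;> rfl
  | cons x v ih =>
    cases d with
    | nil => rfl
    | cons y d => rw [withAddMul, force_eq, ih]; rfl

/-- The `i`-th simple reflection on vectors given by their coordinates with respect to the
fundamental weights. The rows of `C` are the negatives of the simple roots. -/
def reflList (C : List (List ℕ)) (i : ℕ) (v : List ℕ) : List ℕ :=
  addMul (v.getD i 0) v (C.getD i [])

/-- Part of the orbit of `v` under the simple reflections with index in `K`: a vector `y ≠ v` is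
listed below its image under the first simple reflection for which it has a negative coordinate,
where residues in `[1, 14]` count as positive and those in `[15, 28]` as negative. -/
def orbitTree (C : List (List ℕ)) (K : List ℕ) : ℕ → List ℕ → List (List ℕ)
  | 0, v => [v]
  | k + 1, v => v :: K.flatMap fun i ↦
      bif Nat.ble 1 (v.getD i 0) && Nat.ble (v.getD i 0) 14 then
        withAddMul (v.getD i 0) v (C.getD i []) fun y ↦
          bif K.all fun j ↦ Nat.ble i j || Nat.ble (y.getD j 0) 14 then orbitTree C K k y else []
      else []

/-- Soundness only: every listed vector is reachable. The sign rule that prunes the tree needs no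
justification, since the number of listed vectors and their distinctness are checked by evaluation.
-/
theorem orbitTree_forall {C : List (List ℕ)} {K : List ℕ} {P : List ℕ → Prop}
    (hP : ∀ v, P v → ∀ i ∈ K, P (reflList C i v)) (k : ℕ) (v : List ℕ) (hv : P v) :
    ∀ y ∈ orbitTree C K k v, P y := by
  induction k generalizing v with
  | zero => simpa [orbitTree] using hv
  | succ k ih =>
    intro y hy
    rw [orbitTree, List.mem_cons, List.mem_flatMap] at hy
    rcases hy with rfl | ⟨i, hi, hy⟩
    · exact hv
    · rw [withAddMul_eq] at hy
      simp only [cond_eq_ite] at hy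
      split_ifs at hy
      · exact ih _ (hP v hv i hi) y hy
      · simp at hy
      · simp at hy

/-- A natural number encoding a vector. -/
def code (v : List ℕ) : ℕ := v.foldr (fun x y ↦ x + 32 * y) 0

/-- Apply `f` to the evaluated codes of the vectors in a list. -/
def withCodes {α : Type*} : List (List ℕ) → (List ℕ → α) → α
  | [], f => f []
  | v :: l, f => force (code v) fun x ↦ withCodes l fun m ↦ f (x :: m)

theorem withCodes_eq {α : Type*} (l : List (List ℕ)) (f : List ℕ → α) :
    withCodes l f = f (l.map code) := by
  induction l generalizing f with
  | nil => rfl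
  | cons v l ih => rw [withCodes, force_eq, ih]; rfl

/-- A test for numbers with at most `k` binary digits to be pairwise distinct. -/
def distinct : ℕ → List ℕ → Bool
  | _, [] => true
  | _, [_] => true
  | 0, _ => false
  | k + 1, l => distinct k (l.filter fun x ↦ Nat.beq (x / 2 ^ k % 2) 0) &&
      distinct k (l.filter fun x ↦ Nat.beq (x / 2 ^ k % 2) 1)

/-- Equal numbers have equal binary digits, so a repeated entry would stay together through every
split. -/
theorem nodup_of_distinct {k : ℕ} {l : List ℕ} (h : distinct k l = true) : l.Nodup := by
  induction k generalizing l with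
  | zero =>
    match l, h with
    | [], _ => simp
    | [_], _ => simp
  | succ k ih =>
    match l, h with
    | [], _ => simp
    | [_], _ => simp
    | x :: y :: l, h =>
      rw [distinct, Bool.and_eq_true] at h
      · obtain ⟨h0, h1⟩ := h
        rw [List.nodup_iff_count_le_one]
        intro z
        rcases Nat.mod_two_eq_zero_or_one (z / 2 ^ k) with hz | hz
        · have := List.nodup_iff_count_le_one.mp (ih h0) z
          rwa [List.count_filter (by simp [hz])] at this
        · have := List.nodup_iff_count_le_one.mp (ih h1) z
          rwa [List.count_filter (by simp [hz])] at this
      · exact List.cons_ne_nil _ _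
      · simp

/-- The coordinates of the `k`-th fundamental weight. -/
def weight (n k : ℕ) : List ℕ := (List.range n).map fun j ↦ bif Nat.beq j k then 1 else 0

/-- Check that, for every entry `(k, m)` of the list, the orbit of the `k`-th fundamental weight
under the simple reflections in this and the following entries has `m` listed elements. -/
def checkChain (C : List (List ℕ)) (n : ℕ) : List (ℕ × ℕ) → Bool
  | [] => true
  | (k, m) :: t =>
    ((k :: t.map Prod.fst).all fun i ↦ Nat.blt i n) && (t.all fun p ↦ !Nat.beq p.1 k) &&
      (withCodes (orbitTree C (k :: t.map Prod.fst) 60 (weight n k)) fun l ↦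
        Nat.beq l.length m && distinct 40 l) && checkChain C n t

/-- The vector with coordinates represented by the entries of `l`. -/
def ofList (n : ℕ) (l : List ℕ) : Fin n → ZMod 29 := fun j ↦ (l.getD j 0 : ℕ)

theorem ofList_injOn (n : ℕ) :
    Set.InjOn (ofList n) {l | l.length = n ∧ ∀ x ∈ l, x < 29} := by
  rintro l ⟨hl, hl'⟩ m ⟨hm, hm'⟩ h
  refine List.ext_getElem (hl.trans hm.symm) fun i hi hi' ↦ ?_
  have hin : i < n := by rwa [← hl]
  have := congrFun h ⟨i, hin⟩
  simp only [ofList, List.getD_eq_getElem _ _ hi, List.getD_eq_getElem _ _ hi'] at this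
  rw [ZMod.natCast_eq_natCast_iff'] at this
  rwa [Nat.mod_eq_of_lt (hl' _ (List.getElem_mem hi)),
    Nat.mod_eq_of_lt (hm' _ (List.getElem_mem hi'))] at this

theorem ofList_reflList {n : ℕ} {C : List (List ℕ)} {i : Fin n} {v : List ℕ} (hv : v.length = n)
    (hC : (C.getD i []).length = n) :
    ofList n (reflList C i v) = ofList n v + ofList n v i • ofList n (C.getD i []) := by
  ext j
  have h1 : (j : ℕ) < v.length := by rw [hv]; exact j.2
  have h2 : (j : ℕ) < (C.getD i []).length := by rw [hC]; exact j.2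
  have h3 : (j : ℕ) < (reflList C i v).length := by
    simp only [reflList, addMul, List.length_zipWith]; omega
  simp only [ofList, List.getD_eq_getElem _ _ h3, Pi.add_apply, Pi.smul_apply, smul_eq_mul,
    List.getD_eq_getElem _ _ h1, List.getD_eq_getElem _ _ h2]
  simp [reflList, addMul]

theorem ofList_weight {n : ℕ} {k : ℕ} {j : Fin n} (h : (j : ℕ) ≠ k) :
    ofList n (weight n k) j = 0 := by
  have hl : (j : ℕ) < (weight n k).length := by simp [weight]
  rw [ofList, List.getD_eq_getElem _ _ hl]
  simp [weight, h, cond_eq_ite]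

end Computation

/-! ### Group orders from chains of fundamental weights -/

section Chain

variable {n : ℕ} {M : CoxeterMatrix (Fin n)} {W : Type*} [Group W]

/-- Each entry contributes one factor: the k-th fundamental weight is fixed by the simple
reflections of all later entries, and its orbit has at least `m` points. -/
theorem prod_le_card_parabolic [Finite W] (cs : CoxeterSystem M W) {C : List (List ℕ)}
    {ρ : W →* Function.End (Fin n → ZMod 29)}
    (hC : ∀ i : Fin n, (C.getD i []).length = n)
    (hρ : ∀ i v, ρ (cs.simple i) v = v + v i • ofList n (C.getD i []))
    {ch : List (ℕ × ℕ)} (h : checkChain C n ch = true) :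
    (ch.map Prod.snd).prod ≤
      Nat.card (parabolic cs {i : Fin n | (i : ℕ) ∈ ch.map Prod.fst}) := by
  classical
  induction ch with
  | nil => simpa using one_le_card_parabolic cs _
  | cons p t ih =>
    obtain ⟨k, m⟩ := p
    simp only [checkChain, Bool.and_eq_true, withCodes_eq] at h
    obtain ⟨⟨⟨hK, hk⟩, hm, hd⟩, ht⟩ := h
    set K := k :: t.map Prod.fst
    set L := orbitTree C K 60 (weight n k)
    rw [Nat.beq_eq, List.length_map] at hm
    -- Distinct codes force distinct vectors; injectivity of `code` is not needed.
    have hnd : L.Nodup := (nodup_of_distinct hd).of_map _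
    have hreach : ∀ y ∈ L, (y.length = n ∧ ∀ x ∈ y, x < 29) ∧
        Reach (fun j ↦ (ρ (cs.simple j) : (Fin n → ZMod 29) → _)) {i : Fin n | (i : ℕ) ∈ K}
          (ofList n (weight n k)) (ofList n y) := by
      refine orbitTree_forall (fun v hv i hi ↦ ?_) 60 _ ?_
      · have hin : i < n := by simpa using List.all_eq_true.mp hK i hi
        obtain ⟨⟨hv1, -⟩, hv2⟩ := hv
        have hlen := hC ⟨i, hin⟩
        refine ⟨⟨?_, fun x hx ↦ ?_⟩, ?_⟩
        · simp only [reflList, addMul, List.length_zipWith]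
          simp only at hlen
          omega
        · simp only [reflList, addMul] at hx
          obtain ⟨j, hj, rfl⟩ := List.getElem_of_mem hx
          rw [List.getElem_zipWith]
          exact Nat.mod_lt _ (by norm_num)
        · have := hv2.step (j := ⟨i, hin⟩) hi
          rwa [hρ, ← ofList_reflList hv1 hlen] at this
      · refine ⟨⟨by simp [weight], fun x hx ↦ ?_⟩, .refl⟩
        simp only [weight, List.mem_map, cond_eq_ite] at hx
        obtain ⟨j, -, rfl⟩ := hx
        split_ifs <;> norm_num
    have hinj : ∀ x ∈ L, ∀ y ∈ L, ofList n x = ofList n y → x = y := fun x hx y hy hxy ↦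
      ofList_injOn n (hreach x hx).1 (hreach y hy).1 hxy
    have hcard := card_mul_card_parabolic_le cs ρ
      (J := {i : Fin n | (i : ℕ) ∈ t.map Prod.fst}) (K := {i : Fin n | (i : ℕ) ∈ K})
      (fun i hi ↦ List.mem_cons_of_mem _ hi) (x := ofList n (weight n k)) (fun j hj ↦ ?_)
      (L.map (ofList n)).toFinset (fun y hy ↦ ?_)
    · rw [List.toFinset_card_of_nodup (hnd.map_on hinj), List.length_map, hm] at hcard
      rw [List.map_cons, List.prod_cons]
      exact (Nat.mul_le_mul_left _ (ih ht)).trans hcard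
    · obtain ⟨p, hp, hpj⟩ := List.mem_map.mp hj
      have hne : (j : ℕ) ≠ k := by
        have := List.all_eq_true.mp hk p hp
        intro he
        rw [hpj, he, Nat.beq_refl] at this
        exact Bool.false_ne_true this
      rw [hρ, ofList_weight hne, zero_smul, add_zero]
    · obtain ⟨z, hz, rfl⟩ := List.mem_map.mp (List.mem_toFinset.mp hy)
      exact (hreach z hz).2

/-- The rows of `C` represent the negative of a Cartan matrix for the Coxeter matrix `M`. -/
def IsNegCartan (M : CoxeterMatrix (Fin n)) (C : List (List ℕ)) : Prop :=
  (∀ i : Fin n, (C.getD i []).length = n) ∧ (∀ i : Fin n, ofList n (C.getD i []) i = -2) ∧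
    ∀ i j : Fin n, i = j ∨
      Compatible (M i j) (-ofList n (C.getD j []) i) (-ofList n (C.getD i []) j)

instance (m : ℕ) (p q : ZMod 29) : Decidable (Compatible m p q) := by
  unfold Compatible; infer_instance

instance (M : CoxeterMatrix (Fin n)) (C : List (List ℕ)) : Decidable (IsNegCartan M C) :=
  have : Decidable (∀ i j : Fin n, i = j ∨
      Compatible (M i j) (-ofList n (C.getD j []) i) (-ofList n (C.getD i []) j)) :=
    @Nat.decidableForallFin _ _ fun _ ↦ @Nat.decidableForallFin _ _ fun _ ↦ inferInstance
  inferInstanceAs (Decidable (_ ∧ _ ∧ _))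

theorem prod_le_card [Finite W] (cs : CoxeterSystem M W) {C : List (List ℕ)}
    (hC : IsNegCartan M C) {ch : List (ℕ × ℕ)} (h : checkChain C n ch = true) :
    (ch.map Prod.snd).prod ≤ Nat.card W := by
  obtain ⟨hC, h2, hM⟩ := hC
  obtain ⟨ρ, hρ⟩ := exists_reflection_action cs (fun i : Fin n ↦ -ofList n (C.getD i []))
    (fun i ↦ LinearMap.proj i) (fun i ↦ by rw [LinearMap.proj_apply, Pi.neg_apply, h2, neg_neg])
    fun i j hij ↦ (hM i j).resolve_left hij
  refine (prod_le_card_parabolic cs hC (ρ := ρ) (fun i v ↦ ?_) h).trans (card_parabolic_le cs _)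
  rw [hρ]
  simp

end Chain

/-! ### Orders of the groups of types A, B and D -/

section Classical

variable {W : Type*} [Group W] {n : ℕ}

/-- The standard basis vectors of the space of integer sequences. -/
def e (j : ℕ) : ℕ → ℤ := Pi.single j 1

theorem e_apply (j k : ℕ) : e j k = if k = j then 1 else 0 := Pi.single_apply _ _ _

theorem e_injective : Function.Injective e := fun j k h ↦ by
  have := congrFun h j
  simp only [e_apply] at this
  by_contra hn
  simp [hn] at this

theorem e_ne_neg_e (j k : ℕ) : e j ≠ -e k := fun h ↦ by
  have := congrFun h j
  simp only [e_apply, Pi.neg_apply] at this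
  split_ifs at this <;> omega

/-- The coordinate functionals on the space of integer sequences. -/
def coord (j : ℕ) : (ℕ → ℤ) →ₗ[ℤ] ℤ := LinearMap.proj j

theorem coord_e (j k : ℕ) : coord j (e k) = if j = k then 1 else 0 := e_apply k j

open scoped Classical in
/-- The signed basis vectors with index in `[k, n)`. -/
noncomputable def signedBasis (k n : ℕ) : Finset (ℕ → ℤ) :=
  (Finset.Ico k n).image e ∪ (Finset.Ico k n).image fun j ↦ -e j

theorem card_signedBasis (k n : ℕ) : (signedBasis k n).card = 2 * (n - k) := by
  classical
  rw [signedBasis, Finset.card_union_of_disjoint, Finset.card_image_of_injective _ e_injective,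
    Finset.card_image_of_injective _ (f := fun j ↦ -e j) (neg_injective.comp e_injective),
    Nat.card_Ico, two_mul]
  rw [Finset.disjoint_left]
  rintro _ h h'
  obtain ⟨j, -, rfl⟩ := Finset.mem_image.mp h
  obtain ⟨l, -, hl⟩ := Finset.mem_image.mp h'
  exact e_ne_neg_e _ _ hl.symm

theorem factorial_le_card_A [Finite W] (cs : CoxeterSystem (CoxeterMatrix.A n) W) :
    (n + 1).factorial ≤ Nat.card W := by
  classical
  obtain ⟨ρ, hρ⟩ := exists_reflection_action cs (V := ℕ → ℤ) (R := ℤ)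
    (fun i : Fin n ↦ e i - e (i + 1)) (fun i ↦ coord i - coord (i + 1))
    (fun i ↦ by simp [coord_e]) (fun i j hij ↦ by
      have hij' : (i : ℕ) ≠ j := fun h ↦ hij (Fin.ext h)
      simp only [Compatible, CoxeterMatrix.A, Matrix.of_apply, LinearMap.sub_apply,
        map_sub, coord_e]
      grind)
  -- The last `k` nodes permute the basis vectors with indices n - k, …, n. Passing to k + 1 adds
  -- the vector e(n - k - 1), which the old nodes fix and whose new orbit has k + 2 elements.
  have key : ∀ k ≤ n, (k + 1).factorial ≤
      Nat.card (parabolic cs {i : Fin n | n - k ≤ (i : ℕ)}) := by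
    intro k hk
    induction k with
    | zero => simpa using one_le_card_parabolic cs _
    | succ k ih =>
      have := card_mul_card_parabolic_le cs ρ (J := {i : Fin n | n - k ≤ (i : ℕ)})
        (K := {i : Fin n | n - (k + 1) ≤ (i : ℕ)}) (fun i (hi : n - k ≤ (i : ℕ)) ↦
          (by omega : n - (k + 1) ≤ (i : ℕ))) (x := e (n - (k + 1)))
        (fun j (hj : n - k ≤ (j : ℕ)) ↦ ?_)
        ((Finset.Ico (n - (k + 1)) (n + 1)).image e) (fun y hy ↦ ?_)
      · rw [Finset.card_image_of_injective _ e_injective, Nat.card_Ico,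
          show n + 1 - (n - (k + 1)) = k + 1 + 1 by omega] at this
        rw [Nat.factorial_succ]
        exact (Nat.mul_le_mul_left _ (ih (by omega))).trans this
      · rw [hρ]
        simp only [LinearMap.sub_apply, coord_e]
        rw [if_neg (by omega), if_neg (by omega)]
        simp
      · obtain ⟨j, hj, rfl⟩ := Finset.mem_image.mp hy
        rw [Finset.mem_Ico] at hj
        obtain ⟨hj, hjn⟩ := hj
        induction j, hj using Nat.le_induction with
        | base => exact .refl
        | succ j hj ih' =>
          have hr := (ih' (Finset.mem_image_of_mem _ (by rw [Finset.mem_Ico]; omega))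
            (by omega)).step (j := ⟨j, by omega⟩) hj
          rw [hρ] at hr
          simpa [coord_e] using hr
  have := (key n le_rfl).trans (card_parabolic_le cs _)
  exact this

/-- The path climbs from e k to e (n - 1), uses the turning reflection to reach -e (n - 1), and
descends through the negatives to -e k. In type B the turn starts at e (n - 1), in type D at e (n -
2). -/
theorem reach_signedBasis {B : Type*} {σ : B → (ℕ → ℤ) → ℕ → ℤ} {K : Set B} {k n : ℕ}
    (hup : ∀ j, k ≤ j → j + 1 < n → ∃ b ∈ K, σ b (e j) = e (j + 1) ∧ σ b (-e (j + 1)) = -e j)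
    (hturn : ∃ j, k ≤ j ∧ j < n ∧ ∃ b ∈ K, σ b (e j) = -e (n - 1)) :
    ∀ y ∈ signedBasis k n, Reach σ K (e k) y := by
  classical
  have h1 : ∀ j, k ≤ j → j < n → Reach σ K (e k) (e j) := by
    intro j hj
    induction j, hj using Nat.le_induction with
    | base => exact fun _ ↦ .refl
    | succ j hj ih =>
      intro hjn
      obtain ⟨b, hb, hb1, -⟩ := hup j hj hjn
      exact hb1 ▸ (ih (by omega)).step hb
  have h2 : ∀ i, k + i < n → Reach σ K (e k) (-e (n - 1 - i)) := by
    intro i hi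
    induction i with
    | zero =>
      obtain ⟨j, hkj, hjn, b, hb, hbj⟩ := hturn
      exact hbj ▸ (h1 j hkj hjn).step hb
    | succ i ih =>
      obtain ⟨b, hb, -, hb2⟩ := hup (n - 1 - (i + 1)) (by omega) (by omega)
      rw [show n - 1 - (i + 1) + 1 = n - 1 - i by omega] at hb2
      exact hb2 ▸ (ih (by omega)).step hb
  intro y hy
  rcases Finset.mem_union.mp hy with hy | hy
  · obtain ⟨j, hj, rfl⟩ := Finset.mem_image.mp hy
    rw [Finset.mem_Ico] at hj
    exact h1 j hj.1 hj.2
  · obtain ⟨j, hj, rfl⟩ := Finset.mem_image.mp hy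
    rw [Finset.mem_Ico] at hj
    simpa [show n - 1 - (n - 1 - j) = j by omega] using h2 (n - 1 - j) (by omega)

theorem two_pow_mul_factorial_le_card_B [Finite W] (hn : 2 ≤ n)
    (cs : CoxeterSystem (CoxeterMatrix.B n) W) :
    2 ^ n * n.factorial ≤ Nat.card W := by
  obtain ⟨ρ, hρ⟩ := exists_reflection_action cs (V := ℕ → ℤ) (R := ℤ)
    (fun i : Fin n ↦ if (i : ℕ) + 1 = n then e i else e i - e (i + 1))
    (fun i ↦ if (i : ℕ) + 1 = n then 2 • coord i else coord i - coord (i + 1))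
    (fun i ↦ by split_ifs <;> simp [coord_e]) (fun i j hij ↦ by
      have hij' : (i : ℕ) ≠ j := fun h ↦ hij (Fin.ext h)
      simp only [Compatible, CoxeterMatrix.B, Matrix.of_apply]
      split_ifs <;> simp only [LinearMap.sub_apply, LinearMap.smul_apply, map_sub, coord_e] <;>
      grind)
  have key : ∀ k ≤ n, 2 ^ k * k.factorial ≤
      Nat.card (parabolic cs {i : Fin n | n - k ≤ (i : ℕ)}) := by
    intro k hk
    induction k with
    | zero => simpa using one_le_card_parabolic cs _
    | succ k ih =>
      have := card_mul_card_parabolic_le cs ρ (J := {i : Fin n | n - k ≤ (i : ℕ)})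
        (K := {i : Fin n | n - (k + 1) ≤ (i : ℕ)}) (fun i (hi : n - k ≤ (i : ℕ)) ↦
          (by omega : n - (k + 1) ≤ (i : ℕ))) (x := e (n - (k + 1)))
        (fun j (hj : n - k ≤ (j : ℕ)) ↦ ?_)
        (signedBasis (n - (k + 1)) n) (reach_signedBasis (fun j hj hjn ↦ ?_) ?_)
      · rw [card_signedBasis, show n - (n - (k + 1)) = k + 1 by omega] at this
        rw [Nat.factorial_succ]
        calc 2 ^ (k + 1) * ((k + 1) * k.factorial)
            = 2 * (k + 1) * (2 ^ k * k.factorial) := by ring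
          _ ≤ _ := (Nat.mul_le_mul_left _ (ih (by omega))).trans this
      · rw [hρ]
        have h1 : (j : ℕ) ≠ n - (k + 1) := by omega
        have h2 : (j : ℕ) + 1 ≠ n - (k + 1) := by omega
        split_ifs <;> simp [coord_e, h1, h2]
      · refine ⟨⟨j, by omega⟩, hj, ?_⟩
        have h1 : j + 1 ≠ n := by omega
        simp only [hρ, h1, coord_e, if_false, LinearMap.sub_apply, map_neg]
        exact ⟨by simp, by simp; abel⟩
      · refine ⟨n - 1, by omega, by omega, ⟨n - 1, by omega⟩, ?_, ?_⟩
        · change n - (k + 1) ≤ n - 1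
          omega
        · have h1 : n - 1 + 1 = n := by omega
          simp [hρ, h1, coord_e, two_smul]
  have := (key n le_rfl).trans (card_parabolic_le cs _)
  exact this

theorem two_pow_mul_factorial_le_card_D [Finite W] (hn : 3 ≤ n)
    (cs : CoxeterSystem (typeD n) W) :
    2 ^ (n - 1) * n.factorial ≤ Nat.card W := by
  obtain ⟨ρ, hρ⟩ := exists_reflection_action cs (V := ℕ → ℤ) (R := ℤ)
    (fun i : Fin n ↦ if (i : ℕ) + 1 = n then e (n - 2) + e (n - 1) else e i - e (i + 1))
    (fun i ↦ if (i : ℕ) + 1 = n then coord (n - 2) + coord (n - 1) else coord i - coord (i + 1))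
    (fun i ↦ by
      have h1 : n - 2 ≠ n - 1 := by omega
      split_ifs <;> simp [coord_e, h1, h1.symm]) (fun i j hij ↦ by
      have hij' : (i : ℕ) ≠ j := fun h ↦ hij (Fin.ext h)
      simp only [Compatible, typeD, Matrix.of_apply]
      split_ifs <;> simp only [LinearMap.sub_apply, LinearMap.add_apply, map_sub, map_add,
        coord_e] <;> grind)
  have orb : ∀ k, k + 2 ≤ n → ∀ y ∈ signedBasis k n,
      Reach (fun j ↦ (ρ (cs.simple j) : (ℕ → ℤ) → ℕ → ℤ)) {i : Fin n | k ≤ (i : ℕ)} (e k) y := by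
    refine fun k hk ↦ reach_signedBasis (fun j hj hjn ↦ ?_) ?_
    · refine ⟨⟨j, by omega⟩, hj, ?_⟩
      have h1 : j + 1 ≠ n := by omega
      simp only [hρ, h1, coord_e, if_false, LinearMap.sub_apply, map_neg]
      exact ⟨by simp, by simp; abel⟩
    · refine ⟨n - 2, by omega, by omega, ⟨n - 1, by omega⟩, (by omega : k ≤ n - 1), ?_⟩
      have h1 : n - 1 + 1 = n := by omega
      have h2 : n - 2 ≠ n - 1 := by omega
      simp [hρ, h1, h2.symm, coord_e]
  have key : ∀ k, 1 ≤ k → k < n → 2 ^ k * (k + 1).factorial ≤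
      Nat.card (parabolic cs {i : Fin n | n - (k + 1) ≤ (i : ℕ)}) := by
    intro k hk
    induction k, hk using Nat.le_induction with
    -- The induction starts with the last two nodes, whose roots are e (n - 2) ∓ e (n - 1): the turn
    -- starts at e (n - 2), so a smaller block does not contain it. The four signed basis vectors
    -- give order at least 4.
    | base =>
      intro hk
      have := card_mul_card_parabolic_le cs ρ (J := ∅) (Set.empty_subset _) (by simp)
        (signedBasis (n - (1 + 1)) n) (orb (n - (1 + 1)) (by omega))
      rw [card_signedBasis, show n - (n - (1 + 1)) = 2 by omega] at this
      exact (Nat.mul_le_mul_left 4 (one_le_card_parabolic cs ∅)).trans this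
    | succ k hk1 ih =>
      intro hk
      have := card_mul_card_parabolic_le cs ρ (J := {i : Fin n | n - (k + 1) ≤ (i : ℕ)})
        (fun i (hi : n - (k + 1) ≤ (i : ℕ)) ↦ (by omega : n - (k + 1 + 1) ≤ (i : ℕ)))
        (fun j (hj : n - (k + 1) ≤ (j : ℕ)) ↦ ?_)
        (signedBasis (n - (k + 1 + 1)) n) (orb (n - (k + 1 + 1)) (by omega))
      · rw [card_signedBasis, show n - (n - (k + 1 + 1)) = k + 1 + 1 by omega] at this
        rw [Nat.factorial_succ]
        calc 2 ^ (k + 1) * ((k + 1 + 1) * (k + 1).factorial)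
            = 2 * (k + 1 + 1) * (2 ^ k * (k + 1).factorial) := by ring
          _ ≤ _ := (Nat.mul_le_mul_left _ (ih (by omega))).trans this
      · rw [hρ]
        have h1 : (j : ℕ) ≠ n - (k + 1 + 1) := by omega
        have h2 : (j : ℕ) + 1 ≠ n - (k + 1 + 1) := by omega
        have h3 : n - 2 ≠ n - (k + 1 + 1) := by omega
        have h4 : n - 1 ≠ n - (k + 1 + 1) := by omega
        split_ifs <;> simp [coord_e, h1, h2, h3, h4]
  have := (key (n - 1) (by omega) (by omega)).trans (card_parabolic_le cs _)
  rwa [show n - 1 + 1 = n by omega] at this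

end Classical

/-! ### Orders of the dihedral and exceptional groups -/

section Order

variable {W : Type*} [Group W]

theorem two_mul_le_card_I [Finite W] {m : ℕ} (hm : 2 ≤ m)
    (cs : CoxeterSystem (CoxeterMatrix.I (m - 2)) W) : 2 * m ≤ Nat.card W := by
  have : NeZero m := ⟨by omega⟩
  have hl : (CoxeterMatrix.I (m - 2)).IsLiftable
      fun i ↦ (DihedralGroup.sr (i.val : ZMod m) : DihedralGroup m) := by
    intro i j
    simp only [CoxeterMatrix.I, Matrix.of_apply, DihedralGroup.sr_mul_sr]
    split_ifs with hij
    · simp [hij, ← DihedralGroup.r_zero]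
    · rw [Nat.sub_add_cancel hm, DihedralGroup.r_pow]
      simp [← DihedralGroup.r_zero]
  let φ := cs.lift ⟨_, hl⟩
  have h0 : φ (cs.simple 0) = .sr 0 := by
    simp [φ, cs.lift_apply_simple hl]
  have h1 : φ (cs.simple 1) = .sr 1 := by
    simp [φ, cs.lift_apply_simple hl]
  have hsurj : Function.Surjective φ := by
    have hr : ∀ i : ZMod m, φ ((cs.simple 0 * cs.simple 1) ^ i.val) = .r i := fun i ↦ by
      rw [map_pow, map_mul, h0, h1, DihedralGroup.sr_mul_sr, DihedralGroup.r_pow]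
      simp
    rintro (i | i)
    · exact ⟨_, hr i⟩
    · refine ⟨cs.simple 0 * (cs.simple 0 * cs.simple 1) ^ i.val, ?_⟩
      rw [map_mul, hr, h0, DihedralGroup.sr_mul_r, zero_add]
  rw [← DihedralGroup.nat_card]
  exact Nat.card_le_card_of_surjective φ hsurj

/-- The negative of the Cartan matrix of type `E₈`. -/
def cartanE₈ : List (List ℕ) :=
  [[27, 0, 1, 0, 0, 0, 0, 0], [0, 27, 0, 1, 0, 0, 0, 0], [1, 0, 27, 1, 0, 0, 0, 0],
    [0, 1, 1, 27, 1, 0, 0, 0], [0, 0, 0, 1, 27, 1, 0, 0], [0, 0, 0, 0, 1, 27, 1, 0],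
    [0, 0, 0, 0, 0, 1, 27, 1], [0, 0, 0, 0, 0, 0, 1, 27]]

/-- The negative of the Cartan matrix of type `E₇`. -/
def cartanE₇ : List (List ℕ) :=
  [[27, 0, 1, 0, 0, 0, 0], [0, 27, 0, 1, 0, 0, 0], [1, 0, 27, 1, 0, 0, 0],
    [0, 1, 1, 27, 1, 0, 0], [0, 0, 0, 1, 27, 1, 0], [0, 0, 0, 0, 1, 27, 1],
    [0, 0, 0, 0, 0, 1, 27]]

/-- The negative of the Cartan matrix of type `E₆`. -/
def cartanE₆ : List (List ℕ) :=
  [[27, 0, 1, 0, 0, 0], [0, 27, 0, 1, 0, 0], [1, 0, 27, 1, 0, 0],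
    [0, 1, 1, 27, 1, 0], [0, 0, 0, 1, 27, 1], [0, 0, 0, 0, 1, 27]]

/-- The negative of the Cartan matrix of type `F₄`. -/
def cartanF₄ : List (List ℕ) :=
  [[27, 1, 0, 0], [1, 27, 2, 0], [0, 1, 27, 1], [0, 0, 1, 27]]

/-- The negative of the Cartan matrix of type `H₃`, where the residue `6` is a golden ratio. -/
def cartanH₃ : List (List ℕ) := [[27, 1, 0], [1, 27, 6], [0, 6, 27]]

/-- The negative of the Cartan matrix of type `H₄`, where the residue `6` is a golden ratio. -/
def cartanH₄ : List (List ℕ) := [[27, 1, 0, 0], [1, 27, 1, 0], [0, 1, 27, 6], [0, 0, 6, 27]]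

/-- Deleting nodes from the end of the long arm gives the chain E₈, E₇, E₆, D₅, A₄, A₂ × A₁, A₁ ×
A₁, A₁. -/
theorem le_card_E₈ [Finite W] (cs : CoxeterSystem CoxeterMatrix.E₈ W) : 696729600 ≤ Nat.card W :=
  prod_le_card cs (C := cartanE₈) (by decide +kernel)
    (ch := [(7, 240), (6, 56), (5, 27), (4, 16), (3, 10), (2, 3), (1, 2), (0, 2)])
    (by decide +kernel)

theorem le_card_E₇ [Finite W] (cs : CoxeterSystem CoxeterMatrix.E₇ W) : 2903040 ≤ Nat.card W :=
  prod_le_card cs (C := cartanE₇) (by decide +kernel)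
    (ch := [(6, 56), (5, 27), (4, 16), (3, 10), (2, 3), (1, 2), (0, 2)]) (by decide +kernel)

theorem le_card_E₆ [Finite W] (cs : CoxeterSystem CoxeterMatrix.E₆ W) : 51840 ≤ Nat.card W :=
  prod_le_card cs (C := cartanE₆) (by decide +kernel)
    (ch := [(5, 27), (4, 16), (3, 10), (2, 3), (1, 2), (0, 2)]) (by decide +kernel)

theorem le_card_F₄ [Finite W] (cs : CoxeterSystem CoxeterMatrix.F₄ W) : 1152 ≤ Nat.card W :=
  prod_le_card cs (C := cartanF₄) (by decide +kernel)
    (ch := [(3, 24), (2, 8), (1, 3), (0, 2)]) (by decide +kernel)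

theorem le_card_H₃ [Finite W] (cs : CoxeterSystem CoxeterMatrix.H₃ W) : 120 ≤ Nat.card W :=
  prod_le_card cs (C := cartanH₃) (by decide +kernel)
    (ch := [(0, 12), (1, 5), (2, 2)]) (by decide +kernel)

/-- The factors 120 and 12 count the vertices of the 600-cell and of the icosahedron. -/
theorem le_card_H₄ [Finite W] (cs : CoxeterSystem CoxeterMatrix.H₄ W) : 14400 ≤ Nat.card W :=
  prod_le_card cs (C := cartanH₄) (by decide +kernel)
    (ch := [(0, 120), (1, 12), (2, 5), (3, 2)]) (by decide +kernel)

end Order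

/-! ### Estimates of the constants -/

section Constants

/-- Here c N = x² / (2 a b s) ≤ 1/2. In the applications `a` is the huge power in the denominator,
which alone dominates N². -/
theorem isoperimetric_of_sq_le {B W : Type*} [Group W] {M : CoxeterMatrix B} [Finite B]
    (cs : CoxeterSystem M W) {N : ℕ} {x a b s : ℝ} (hN : 0 < N) (hx : x = N) (ha : x ^ 2 ≤ a)
    (hb : 1 ≤ b) (hs : 1 ≤ s) (hcard : Finite W → N ≤ Nat.card W) :
    Isoperimetric (weakOrderGraph cs) (1 / 2 * (x / (a * b * s))) N := by
  have hx0 : 0 < x := by rw [hx]; exact_mod_cast hN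
  have ha0 : 0 < a := lt_of_lt_of_le (by positivity) ha
  refine isoperimetric_of_le cs (by positivity) hN ?_ hcard
  rw [← hx]
  have h1 : x ^ 2 ≤ a * b * s :=
    calc x ^ 2 ≤ a := ha
      _ = a * 1 * 1 := by ring
      _ ≤ a * b * s := by gcongr
  have h2 : x ^ 2 / (a * b * s) ≤ 1 := div_le_one_of_le₀ h1 (by positivity)
  calc 1 / 2 * (x / (a * b * s)) * x = 1 / 2 * (x ^ 2 / (a * b * s)) := by ring
    _ ≤ 4 := by linarith

theorem factorial_succ_sq_le {n : ℕ} (hn : 3 ≤ n) :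
    (n + 1).factorial ^ 2 ≤ n ^ (n + 1).choose 2 := by
  induction n, hn using Nat.le_induction with
  | base => decide
  | succ n hn ih =>
    have h1 : (n + 1 + 1).choose 2 = (n + 1).choose 2 + (n + 1) := by
      rw [Nat.choose_succ_succ' (n + 1) 1, Nat.choose_one_right, add_comm]
    rw [Nat.factorial_succ, mul_pow, h1, pow_add, mul_comm]
    refine Nat.mul_le_mul (ih.trans (Nat.pow_le_pow_left (by omega) _)) ?_
    calc (n + 1 + 1) ^ 2 ≤ (n + 1) ^ 3 := by nlinarith
      _ ≤ (n + 1) ^ (n + 1) := Nat.pow_le_pow_right (by omega) (by omega)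

theorem two_pow_mul_factorial_sq_le {n : ℕ} (hn : 3 ≤ n) :
    (2 ^ n * n.factorial) ^ 2 ≤ n ^ n ^ 2 := by
  induction n, hn using Nat.le_induction with
  | base => decide
  | succ n hn ih =>
    have h1 : (n + 1) ^ 2 = n ^ 2 + (2 * n + 1) := by ring
    rw [Nat.factorial_succ, show 2 ^ (n + 1) * ((n + 1) * n.factorial) =
      2 ^ n * n.factorial * (2 * (n + 1)) by ring, mul_pow, h1, pow_add]
    refine Nat.mul_le_mul (ih.trans (Nat.pow_le_pow_left (by omega) _)) ?_
    calc (2 * (n + 1)) ^ 2 ≤ (n + 1) ^ 3 := by nlinarith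
      _ ≤ (n + 1) ^ (2 * n + 1) := Nat.pow_le_pow_right (by omega) (by omega)

theorem two_pow_pred_mul_factorial_sq_le {n : ℕ} (hn : 3 ≤ n) :
    (2 ^ (n - 1) * n.factorial) ^ 2 ≤ n ^ (n * (n - 1)) := by
  obtain ⟨k, rfl⟩ : ∃ k, n = k + 1 := ⟨n - 1, by omega⟩
  replace hn : 2 ≤ k := by omega
  rw [Nat.add_sub_cancel]
  induction k, hn using Nat.le_induction with
  | base => decide
  | succ k hk ih =>
    have h1 : (k + 1 + 1) * (k + 1) = (k + 1) * k + (2 * k + 2) := by ring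
    rw [Nat.factorial_succ, show 2 ^ (k + 1) * ((k + 1 + 1) * (k + 1).factorial) =
      2 ^ k * (k + 1).factorial * (2 * (k + 1 + 1)) by ring, mul_pow, h1, pow_add]
    refine Nat.mul_le_mul (ih.trans (Nat.pow_le_pow_left (by omega) _)) ?_
    calc (2 * (k + 1 + 1)) ^ 2 ≤ (k + 1 + 1) ^ 3 := by nlinarith
      _ ≤ (k + 1 + 1) ^ (2 * k + 2) := Nat.pow_le_pow_right (by omega) (by omega)

/-- This is c N ≤ 4 for I₂(m), squared. -/
theorem sq_le_two_pow {m : ℕ} (hm : 2 ≤ m) : m ^ 2 ≤ 16 * 2 ^ (m - 1) := by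
  obtain ⟨k, rfl⟩ : ∃ k, m = k + 1 := ⟨m - 1, by omega⟩
  rw [Nat.add_sub_cancel]
  clear hm
  induction k with
  | zero => norm_num
  | succ k ih =>
    -- The inductive step needs (k + 2)² ≤ 2 (k + 1)², that is k² ≥ 2.
    rcases Nat.lt_or_ge k 2 with hk | hk
    · interval_cases k <;> norm_num
    · rw [pow_succ 2]
      nlinarith

theorem one_half_le_cos {n : ℕ} (hn : 3 ≤ n) : 1 / 2 ≤ Real.cos (Real.pi / n) := by
  rw [← Real.cos_pi_div_three]
  have : (3 : ℝ) ≤ n := by exact_mod_cast hn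
  refine Real.cos_le_cos_of_nonneg_of_le_pi (by positivity) ?_ ?_
  · linarith [Real.pi_pos]
  · exact div_le_div_of_nonneg_left Real.pi_pos.le (by norm_num) this

theorem one_le_two_mul_sqrt {x : ℝ} (hx : 1 / 2 ≤ x) : 1 ≤ 2 * Real.sqrt x := by
  have : 1 / 2 ≤ Real.sqrt x := Real.le_sqrt_of_sq_le (by linarith)
  linarith

theorem one_le_sqrt_two_mul_sqrt {x : ℝ} (hx : 1 ≤ x) : 1 ≤ Real.sqrt (2 * Real.sqrt x) := by
  rw [Real.one_le_sqrt]
  have : 1 ≤ Real.sqrt x := Real.one_le_sqrt.mpr hx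
  linarith

end Constants

end WeakOrder

/-! ### The theorem, type by type -/

theorem mainTheorem10 {W : Type*} [Group W] :
    -- type `A n`
    (∀ n : ℕ, 1 ≤ n → n ≠ 2 → ∀ cs : CoxeterSystem (CoxeterMatrix.A n) W,
      WeakOrder.Isoperimetric (WeakOrder.weakOrderGraph cs)
        (1 / 2 * ((Nat.factorial (n + 1) : ℝ) /
          ((n : ℝ) ^ (Nat.choose (n + 1) 2) * (Nat.choose (n + 1) 2 : ℝ) *
            (2 * Real.sqrt |Real.cos (Real.pi / (n : ℝ))|))))
        (Nat.factorial (n + 1))) ∧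
    -- type `B n`
    (∀ n : ℕ, 3 ≤ n → ∀ cs : CoxeterSystem (CoxeterMatrix.B n) W,
      WeakOrder.Isoperimetric (WeakOrder.weakOrderGraph cs)
        (1 / 2 * ((2 : ℝ) ^ n * (Nat.factorial n : ℝ) /
          ((n : ℝ) ^ (n ^ 2) * (n : ℝ) ^ 2 *
            (2 * Real.sqrt (Real.cos (Real.pi / (n : ℝ)))))))
        (2 ^ n * Nat.factorial n)) ∧
    -- type `D n`
    (∀ n : ℕ, 3 ≤ n → ∀ cs : CoxeterSystem (WeakOrder.typeD n) W,
      WeakOrder.Isoperimetric (WeakOrder.weakOrderGraph cs)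
        (1 / 2 * ((2 : ℝ) ^ (n - 1) * (Nat.factorial n : ℝ) /
          ((n : ℝ) ^ (n * (n - 1)) * ((n : ℝ) * ((n : ℝ) - 1)) * (2 * Real.sqrt 2))))
        (2 ^ (n - 1) * Nat.factorial n)) ∧
    -- type `I₂(m)`; `CoxeterMatrix.I k` is the matrix with off-diagonal entry `k + 2`
    (∀ m : ℕ, 2 ≤ m → ∀ cs : CoxeterSystem (CoxeterMatrix.I (m - 2)) W,
      WeakOrder.Isoperimetric (WeakOrder.weakOrderGraph cs)
        (1 / 2 * Real.sqrt (1 / (2 : ℝ) ^ (m - 1))) (2 * m)) ∧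
    -- type `E₆`
    (∀ cs : CoxeterSystem CoxeterMatrix.E₆ W,
      WeakOrder.Isoperimetric (WeakOrder.weakOrderGraph cs)
        (1 / 2 * (51840 / ((12 : ℝ) ^ 36 * 36 * Real.sqrt 4.8))) 51840 ∧
      WeakOrder.Isoperimetric (WeakOrder.weakOrderGraph cs)
        (1 / 2 * (51840 / ((6 : ℝ) ^ 36 * 36 * Real.sqrt 4.8))) 51840) ∧
    -- type `E₇`
    (∀ cs : CoxeterSystem CoxeterMatrix.E₇ W,
      WeakOrder.Isoperimetric (WeakOrder.weakOrderGraph cs)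
        (1 / 2 * (2903040 / ((12 : ℝ) ^ 36 * 36 * Real.sqrt 4.8))) 2903040 ∧
      WeakOrder.Isoperimetric (WeakOrder.weakOrderGraph cs)
        (1 / 2 * (2903040 / ((7 : ℝ) ^ 63 * 63 * Real.sqrt 4.8))) 2903040) ∧
    -- type `E₈`
    (∀ cs : CoxeterSystem CoxeterMatrix.E₈ W,
      WeakOrder.Isoperimetric (WeakOrder.weakOrderGraph cs)
        (1 / 2 * (696729600 / ((30 : ℝ) ^ 120 * 20 * Real.sqrt 4.8))) 696729600 ∧
      WeakOrder.Isoperimetric (WeakOrder.weakOrderGraph cs)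
        (1 / 2 * (696729600 / ((8 : ℝ) ^ 120 * 120 * Real.sqrt 4.8))) 696729600) ∧
    -- type `F₄`
    (∀ cs : CoxeterSystem CoxeterMatrix.F₄ W,
      WeakOrder.Isoperimetric (WeakOrder.weakOrderGraph cs)
        (1 / 2 * (1152 / ((12 : ℝ) ^ 24 * 24 * Real.sqrt (2 * Real.sqrt 2)))) 1152 ∧
      WeakOrder.Isoperimetric (WeakOrder.weakOrderGraph cs)
        (1 / 2 * (1152 / ((4 : ℝ) ^ 24 * 24 * Real.sqrt (2 * Real.sqrt 2)))) 1152) ∧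
    -- type `H₃`
    (∀ cs : CoxeterSystem CoxeterMatrix.H₃ W,
      WeakOrder.Isoperimetric (WeakOrder.weakOrderGraph cs)
        (4 / ((10 : ℝ) ^ 15 * Real.sqrt (2 * Real.sqrt 3))) 120 ∧
      WeakOrder.Isoperimetric (WeakOrder.weakOrderGraph cs)
        (1 / 2 * (120 / ((3 : ℝ) ^ 15 * 15 * Real.sqrt 2))) 120) ∧
    -- type `H₄`
    (∀ cs : CoxeterSystem CoxeterMatrix.H₄ W,
      WeakOrder.Isoperimetric (WeakOrder.weakOrderGraph cs)
        (1 / 2 * (14400 / ((30 : ℝ) ^ 60 * 60 * Real.sqrt (2 * Real.sqrt 2)))) 14400 ∧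
      WeakOrder.Isoperimetric (WeakOrder.weakOrderGraph cs)
        (1 / 2 * (14400 / ((4 : ℝ) ^ 60 * 60 * Real.sqrt (2 * Real.sqrt 2)))) 14400) := by
  have h48 : 1 ≤ Real.sqrt 4.8 := Real.one_le_sqrt.mpr (by norm_num)
  have h2 : 1 ≤ Real.sqrt 2 := Real.one_le_sqrt.mpr (by norm_num)
  have h22 : 1 ≤ Real.sqrt (2 * Real.sqrt 2) := WeakOrder.one_le_sqrt_two_mul_sqrt (by norm_num)
  refine ⟨fun n hn1 hn2 cs ↦ ?_, fun n hn cs ↦ ?_, fun n hn cs ↦ ?_, fun m hm cs ↦ ?_,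
    fun cs ↦ ⟨?_, ?_⟩, fun cs ↦ ⟨?_, ?_⟩, fun cs ↦ ⟨?_, ?_⟩, fun cs ↦ ⟨?_, ?_⟩,
    fun cs ↦ ⟨?_, ?_⟩, fun cs ↦ ⟨?_, ?_⟩⟩
  · rcases Nat.lt_or_ge n 3 with hn | hn
    -- For A₁ the power in the denominator is 1 < N², so c N = 1 is computed directly.
    · obtain rfl : n = 1 := by omega
      refine WeakOrder.isoperimetric_of_le cs (by positivity) (by decide) ?_
        fun _ ↦ WeakOrder.factorial_le_card_A cs
      norm_num [Nat.factorial]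
    · refine WeakOrder.isoperimetric_of_sq_le cs (Nat.factorial_pos _) rfl
        (by exact_mod_cast WeakOrder.factorial_succ_sq_le hn)
        (by exact_mod_cast Nat.choose_pos (by omega)) ?_ fun _ ↦ WeakOrder.factorial_le_card_A cs
      exact WeakOrder.one_le_two_mul_sqrt ((WeakOrder.one_half_le_cos hn).trans (le_abs_self _))
  · have hn' : (3 : ℝ) ≤ n := by exact_mod_cast hn
    exact WeakOrder.isoperimetric_of_sq_le cs (by positivity) (by push_cast; ring)
      (by exact_mod_cast WeakOrder.two_pow_mul_factorial_sq_le hn) (by nlinarith)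
      (WeakOrder.one_le_two_mul_sqrt (WeakOrder.one_half_le_cos hn))
      fun _ ↦ WeakOrder.two_pow_mul_factorial_le_card_B (by omega) cs
  · have hn' : (3 : ℝ) ≤ n := by exact_mod_cast hn
    exact WeakOrder.isoperimetric_of_sq_le cs (by positivity) (by push_cast; ring)
      (by exact_mod_cast WeakOrder.two_pow_pred_mul_factorial_sq_le hn) (by nlinarith)
      (WeakOrder.one_le_two_mul_sqrt (by norm_num))
      fun _ ↦ WeakOrder.two_pow_mul_factorial_le_card_D hn cs
  · refine WeakOrder.isoperimetric_of_le cs (by positivity) (by omega) ?_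
      fun _ ↦ WeakOrder.two_mul_le_card_I hm cs
    have hm' : (0 : ℝ) < m := by exact_mod_cast (by omega : 0 < m)
    have h1 : (m : ℝ) ^ 2 ≤ 16 * 2 ^ (m - 1) := by exact_mod_cast WeakOrder.sq_le_two_pow hm
    have h3 : Real.sqrt (1 / (2 : ℝ) ^ (m - 1)) ≤ 4 / m := by
      refine Real.sqrt_le_iff.mpr ⟨by positivity, ?_⟩
      rw [div_pow, div_le_div_iff₀ (by positivity) (by positivity)]
      linarith
    rw [le_div_iff₀ hm'] at h3
    push_cast
    linarith
  · exact WeakOrder.isoperimetric_of_sq_le cs (by norm_num) (by norm_num) (by norm_num) (by norm_num)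
      h48 fun _ ↦ WeakOrder.le_card_E₆ cs
  · exact WeakOrder.isoperimetric_of_sq_le cs (by norm_num) (by norm_num) (by norm_num) (by norm_num)
      h48 fun _ ↦ WeakOrder.le_card_E₆ cs
  · exact WeakOrder.isoperimetric_of_sq_le cs (by norm_num) (by norm_num) (by norm_num) (by norm_num)
      h48 fun _ ↦ WeakOrder.le_card_E₇ cs
  · exact WeakOrder.isoperimetric_of_sq_le cs (by norm_num) (by norm_num) (by norm_num) (by norm_num)
      h48 fun _ ↦ WeakOrder.le_card_E₇ cs
  · exact WeakOrder.isoperimetric_of_sq_le cs (by norm_num) (by norm_num) (by norm_num) (by norm_num)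
      h48 fun _ ↦ WeakOrder.le_card_E₈ cs
  · exact WeakOrder.isoperimetric_of_sq_le cs (by norm_num) (by norm_num) (by norm_num) (by norm_num)
      h48 fun _ ↦ WeakOrder.le_card_E₈ cs
  · exact WeakOrder.isoperimetric_of_sq_le cs (by norm_num) (by norm_num) (by norm_num) (by norm_num)
      h22 fun _ ↦ WeakOrder.le_card_F₄ cs
  · exact WeakOrder.isoperimetric_of_sq_le cs (by norm_num) (by norm_num) (by norm_num) (by norm_num)
      h22 fun _ ↦ WeakOrder.le_card_F₄ cs
  -- This constant is not of the form N/(2 a b s) with N = 120 displayed, so c N ≤ 4 is checked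
  -- directly.
  · refine WeakOrder.isoperimetric_of_le cs (by positivity) (by norm_num) ?_ fun _ ↦ WeakOrder.le_card_H₃ cs
    have h3 : 1 ≤ Real.sqrt (2 * Real.sqrt 3) := WeakOrder.one_le_sqrt_two_mul_sqrt (by norm_num)
    rw [div_mul_eq_mul_div, div_le_iff₀ (by positivity)]
    push_cast
    linarith
  · exact WeakOrder.isoperimetric_of_sq_le cs (by norm_num) (by norm_num) (by norm_num) (by norm_num)
      h2 fun _ ↦ WeakOrder.le_card_H₃ cs
  · exact WeakOrder.isoperimetric_of_sq_le cs (by norm_num) (by norm_num) (by norm_num) (by norm_num)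
      h22 fun _ ↦ WeakOrder.le_card_H₄ cs
  · exact WeakOrder.isoperimetric_of_sq_le cs (by norm_num) (by norm_num) (by norm_num) (by norm_num)
      h22 fun _ ↦ WeakOrder.le_card_H₄ cs
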